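/- Let $n,p\ge 0$ be integers. For $X\in\mathbb{R}^{n\times p}$ and $y\in\mathbb{R}^n$, let $$S_{X,\mathrm{bp}}(y)=\operatorname*{arg\,min}\{\|b\|_1 : b\in\mathbb{R}^p,\ Xb=y\}$$ be the set of basis pursuit minimizers, i.e. the set of all $b\in\mathbb{R}^p$ with $Xb=y$ such that $\|b\|_1\le\|c\|_1$ for every $c\in\mathbb{R}^p$ with $Xc=y$, where $\|b\|_1=\sum_{j=1}^p|b_j|$ (this set is empty if $y$ is not in the column space of $X$). Let $\mu$ be the Lebesgue measure on $\mathbb{R}^{n\times p}$. Then $$\mu\left(\left\{X\in\mathbb{R}^{n\times p} : \exists\, y\in\mathbb{R}^n \text{ with } |S_{X,\mathrm{bp}}(y)|>1\right\}\right)=0.$$ -/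

import Mathlib

open MeasureTheory

/-- The set `S_{X,bp}(y)` of basis pursuit minimizers: all minimizers of `‖b‖₁` subject to
`X b = y`. It is empty when `y` is not in the column space of `X`. -/
def bpMinimizers {n p : ℕ} (X : Matrix (Fin n) (Fin p) ℝ) (y : Fin n → ℝ) :
    Set (Fin p → ℝ) :=
  {b | X.mulVec b = y ∧ IsMinOn (fun c : Fin p → ℝ => ‖WithLp.toLp 1 c‖) {c | X.mulVec c = y} b}

/-- Membership in `bpMinimizers`, with the norm written out as a sum of absolute values. -/
theorem mem_bpMinimizers {n p : ℕ} (X : Matrix (Fin n) (Fin p) ℝ) (y : Fin n → ℝ)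
    (b : Fin p → ℝ) :
    b ∈ bpMinimizers X y ↔
      X.mulVec b = y ∧ ∀ c : Fin p → ℝ, X.mulVec c = y → ∑ j, |b j| ≤ ∑ j, |c j| := by
  simp [bpMinimizers, isMinOn_iff, PiLp.norm_eq_of_L1]

/-! The midpoint `m` of two distinct minimizers is a minimizer whose support `E` contains both
supports. By first-order optimality, kernel vectors supported in `E` are orthogonal to `sign m`. If
`E` has at most `n + 1` elements, the difference of the minimizers is such a vector; otherwise any
`n + 1` columns indexed in `E` are dependent and give one. So the kernel meets nontrivially one of
finitely many subspaces of dimension at most `n`, indexed by a support and a sign pattern. For each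
fixed subspace this happens only on a null set of matrices, by induction on the rows. -/

/-- The matrices whose kernel meets a given subspace trivially form an open set. -/
theorem isOpen_setOf_forall_mem_dotProduct_ne_zero {n p : ℕ} (V : Submodule ℝ (Fin p → ℝ)) :
    IsOpen {X : Fin n → Fin p → ℝ | ∀ h ∈ V, (∀ i, X i ⬝ᵥ h = 0) → h = 0} := by
  have hK : IsCompact ((V : Set (Fin p → ℝ)) ∩ Metric.sphere 0 1) :=
    (isCompact_sphere _ _).inter_left V.closed_of_finiteDimensional
  have : CompactSpace ↥((V : Set (Fin p → ℝ)) ∩ Metric.sphere 0 1) :=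
    isCompact_iff_compactSpace.mp hK
  have hc : IsClosed {q : (Fin n → Fin p → ℝ) × ↥((V : Set (Fin p → ℝ)) ∩ Metric.sphere 0 1) |
      ∀ i, q.1 i ⬝ᵥ (q.2 : Fin p → ℝ) = 0} := by
    simp only [Set.ofPred_forall]
    refine isClosed_iInter fun i => isClosed_eq ?_ continuous_const
    exact ((continuous_apply i).comp continuous_fst).dotProduct
      (continuous_subtype_val.comp continuous_snd)
  -- Bad matrices are the projection of a closed set along the compact unit sphere of `V`.
  have hcl := isClosedMap_fst_of_compactSpace _ hc
  rw [← isClosed_compl_iff]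
  convert hcl using 1
  ext X
  simp only [Set.mem_compl_iff, Set.mem_ofPred_eq, Set.mem_image, Prod.exists, Subtype.exists,
    exists_and_right, exists_eq_right]
  push Not
  constructor
  · rintro ⟨h, hV, hX, h0⟩
    refine ⟨‖h‖⁻¹ • h, ⟨V.smul_mem _ hV, ?_⟩, fun i => ?_⟩
    · simp [norm_smul, h0]
    · simp [hX i]
  · rintro ⟨h, ⟨hV, h1⟩, hX⟩
    refine ⟨h, hV, hX, ?_⟩
    rintro rfl
    simp at h1

/-- The orthogonal complement of a nonzero subspace is a Lebesgue null set. -/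
theorem ae_exists_mem_dotProduct_ne_zero {p : ℕ} (V : Submodule ℝ (Fin p → ℝ)) (hV : V ≠ ⊥) :
    ∀ᵐ x : Fin p → ℝ, ∃ h ∈ V, x ⬝ᵥ h ≠ 0 := by
  obtain ⟨h, hh, h0⟩ := V.exists_mem_ne_zero_of_ne_bot hV
  have key : (volume : Measure (Fin p → ℝ))
      (LinearMap.ker (dotProductBilin ℝ ℝ h : (Fin p → ℝ) →ₗ[ℝ] ℝ) : Set (Fin p → ℝ)) = 0 := by
    refine Measure.addHaar_submodule _ _ fun htop => h0 ?_
    have : h ∈ LinearMap.ker (dotProductBilin ℝ ℝ h : (Fin p → ℝ) →ₗ[ℝ] ℝ) := by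
      rw [htop]; trivial
    exact dotProduct_self_eq_zero.mp this
  filter_upwards [measure_eq_zero_iff_ae_notMem.mp key] with x hx
  exact ⟨h, hh, fun hxh => hx (by simpa [dotProduct_comm] using hxh)⟩

/-- For almost every matrix with `n` rows, the kernel meets a given subspace of dimension at most
`n` trivially. -/
theorem ae_forall_mem_dotProduct_eq_zero {p : ℕ} (n : ℕ) (V : Submodule ℝ (Fin p → ℝ))
    (hV : Module.finrank ℝ V ≤ n) :
    ∀ᵐ X : Fin n → Fin p → ℝ, ∀ h ∈ V, (∀ i, X i ⬝ᵥ h = 0) → h = 0 := by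
  induction n generalizing V with
  | zero =>
    have : V = ⊥ := Submodule.finrank_eq_zero.mp (Nat.le_zero.mp hV)
    subst this
    exact Filter.Eventually.of_forall fun X h hh _ => by simpa using hh
  | succ n ih =>
    by_cases hbot : V = ⊥
    · subst hbot
      exact Filter.Eventually.of_forall fun X h hh _ => by simpa using hh
    have hmp := volume_preserving_piFinSuccAbove (fun _ : Fin (n + 1) => Fin p → ℝ) 0
    -- Openness serves only to supply the measurability that Fubini needs.
    have hopen := isOpen_setOf_forall_mem_dotProduct_ne_zero (n := n + 1) V
    have hprod : ∀ᵐ q : (Fin p → ℝ) × (Fin n → Fin p → ℝ),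
        (MeasurableEquiv.piFinSuccAbove (fun _ : Fin (n + 1) => Fin p → ℝ) 0).symm q ∈
          {X : Fin (n + 1) → Fin p → ℝ | ∀ h ∈ V, (∀ i, X i ⬝ᵥ h = 0) → h = 0} := by
      rw [Measure.volume_eq_prod]
      refine (Measure.ae_prod_iff_ae_ae (hopen.measurableSet.preimage
        (MeasurableEquiv.measurable _))).mpr ?_
      filter_upwards [ae_exists_mem_dotProduct_ne_zero V hbot] with x ⟨h, hh, hxh⟩
      set L : (Fin p → ℝ) →ₗ[ℝ] ℝ := dotProductBilin ℝ ℝ x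
      -- A generic first row cuts the dimension, leaving a smaller subspace for the other `n` rows.
      have hlt : V ⊓ LinearMap.ker L < V := by
        refine lt_of_le_of_ne inf_le_left fun heq => hxh ?_
        rw [← heq] at hh
        exact hh.2
      filter_upwards [ih (V ⊓ LinearMap.ker L)
        (by have := Submodule.finrank_lt_finrank_of_lt hlt; omega)] with Y hY g hg hX
      refine hY g ⟨hg, ?_⟩ fun i => ?_
      · exact hX 0
      · simpa using hX i.succ
    filter_upwards [hmp.quasiMeasurePreserving.ae hprod] with X hX
    simpa using hX

/-- The vectors supported on a set of at most `n + 1` indices and orthogonal to a vector which is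
nonzero on that set lie in a subspace of dimension at most `n`. -/
theorem exists_submodule_finrank_le_of_card_le {n p : ℕ} (F : Finset (Fin p)) (s : Fin p → ℝ)
    (hF : F.card ≤ n + 1) (hs : ∀ j ∈ F, s j ≠ 0) :
    ∃ V : Submodule ℝ (Fin p → ℝ), Module.finrank ℝ V ≤ n ∧
      ∀ h : Fin p → ℝ, (∀ j ∉ F, h j = 0) → s ⬝ᵥ h = 0 → h ∈ V := by
  classical
  set W := Submodule.span ℝ
    ((F.image fun j => (Pi.single j 1 : Fin p → ℝ) : Finset (Fin p → ℝ)) : Set (Fin p → ℝ))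
  set L : (Fin p → ℝ) →ₗ[ℝ] ℝ := dotProductBilin ℝ ℝ s
  have hW : Module.finrank ℝ W ≤ F.card :=
    (finrank_span_finset_le_card _).trans Finset.card_image_le
  refine ⟨W ⊓ LinearMap.ker L, ?_, fun h hh hsh => ⟨?_, hsh⟩⟩
  -- For empty `F` the hyperplane cuts nothing, but `W` is already zero.
  · rcases F.eq_empty_or_nonempty with rfl | ⟨j, hj⟩
    · have := Submodule.finrank_mono (inf_le_left : W ⊓ LinearMap.ker L ≤ W)
      simp only [Finset.card_empty] at hW
      omega
    · have hlt : W ⊓ LinearMap.ker L < W := by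
        refine lt_of_le_of_ne inf_le_left fun heq => hs j hj ?_
        have hm : (Pi.single j 1 : Fin p → ℝ) ∈ W :=
          Submodule.subset_span (Finset.mem_coe.mpr (Finset.mem_image_of_mem _ hj))
        rw [← heq] at hm
        simpa [L] using hm.2
      have := Submodule.finrank_lt_finrank_of_lt hlt
      omega
  · have hsum : h = ∑ j ∈ F, h j • (Pi.single j 1 : Fin p → ℝ) := by
      ext k
      by_cases hk : k ∈ F <;> simp [Finset.sum_apply, Pi.single_apply, hk, hh]
    rw [hsum]
    exact W.sum_mem fun j hj => W.smul_mem _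
      (Submodule.subset_span (Finset.mem_coe.mpr (Finset.mem_image_of_mem _ hj)))

/-- The first-order optimality condition of basis pursuit on the support of a minimizer. -/
theorem sign_dotProduct_eq_zero_of_mem_bpMinimizers {n p : ℕ} {X : Matrix (Fin n) (Fin p) ℝ}
    {y : Fin n → ℝ} {b : Fin p → ℝ} (hb : b ∈ bpMinimizers X y) {h : Fin p → ℝ}
    (hX : X.mulVec h = 0) (hsupp : ∀ j, b j = 0 → h j = 0) :
    (fun j => (SignType.sign (b j) : ℝ)) ⬝ᵥ h = 0 := by
  rw [mem_bpMinimizers] at hb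
  have hnonneg : ∀ g : Fin p → ℝ, X.mulVec g = 0 → (∀ j, b j = 0 → g j = 0) →
      0 ≤ (fun j => (SignType.sign (b j) : ℝ)) ⬝ᵥ g := by
    intro g hXg hg
    -- For small `t > 0` no sign on the support of `b` flips, so the norm is affine in `t`.
    have hev : ∀ᶠ t : ℝ in nhdsWithin 0 (Set.Ioi 0), ∀ j, b j = 0 ∨ |t * g j| < |b j| := by
      refine Filter.eventually_all.mpr fun j => ?_
      rcases eq_or_ne (b j) 0 with hj | hj
      · exact Filter.Eventually.of_forall fun _ => Or.inl hj
      · have hc : Filter.Tendsto (fun t : ℝ => |t * g j|) (nhds 0) (nhds 0) := by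
          have : Continuous fun t : ℝ => |t * g j| := by fun_prop
          simpa using this.tendsto 0
        filter_upwards [nhdsWithin_le_nhds (hc.eventually_lt_const (abs_pos.mpr hj))] with t ht
        exact Or.inr ht
    obtain ⟨t, ht, ht0⟩ := (hev.and self_mem_nhdsWithin).exists
    have ht0 : 0 < t := ht0
    have hle := hb.2 (b + t • g) (by simp [Matrix.mulVec_add, Matrix.mulVec_smul, hXg, hb.1])
    have heq : ∀ j, |(b + t • g) j| = |b j| + t * ((SignType.sign (b j) : ℝ) * g j) := by
      intro j
      simp only [Pi.add_apply, Pi.smul_apply, smul_eq_mul]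
      rcases lt_trichotomy (b j) 0 with hj | hj | hj
      · have h1 := (abs_lt.mp ((ht j).resolve_left hj.ne)).2
        rw [abs_of_neg hj] at h1 ⊢
        rw [abs_of_neg (by linarith)]
        simp [sign_neg hj]
        ring
      · simp [hj, hg j hj]
      · have h1 := (abs_lt.mp ((ht j).resolve_left hj.ne')).1
        rw [abs_of_pos hj] at h1 ⊢
        rw [abs_of_pos (by linarith)]
        simp [sign_pos hj]
    simp only [heq, Finset.sum_add_distrib, ← Finset.mul_sum] at hle
    exact nonneg_of_mul_nonneg_right (by simpa [dotProduct] using hle) ht0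
  refine le_antisymm ?_ (hnonneg h hX hsupp)
  have := hnonneg (-h) (by simp [Matrix.mulVec_neg, hX]) fun j hj => by simp [hsupp j hj]
  simpa using this

/-- The midpoint of two minimizers is a minimizer whose support contains those of both. -/
theorem midpoint_mem_bpMinimizers {n p : ℕ} {X : Matrix (Fin n) (Fin p) ℝ}
    {y : Fin n → ℝ} {b c : Fin p → ℝ} (hb : b ∈ bpMinimizers X y) (hc : c ∈ bpMinimizers X y) :
    (2⁻¹ : ℝ) • (b + c) ∈ bpMinimizers X y ∧
      ∀ j, ((2⁻¹ : ℝ) • (b + c)) j = 0 → b j = 0 ∧ c j = 0 := by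
  rw [mem_bpMinimizers] at hb hc ⊢
  have hX : X.mulVec ((2⁻¹ : ℝ) • (b + c)) = y := by
    rw [Matrix.mulVec_smul, Matrix.mulVec_add, hb.1, hc.1]
    ext i
    simp
    ring
  have hbc := hb.2 c hc.1
  have hcb := hc.2 b hb.1
  have hm := hb.2 _ hX
  have hle : ∀ j ∈ Finset.univ, |((2⁻¹ : ℝ) • (b + c)) j| ≤ 2⁻¹ * (|b j| + |c j|) := by
    intro j _
    simp only [Pi.smul_apply, Pi.add_apply, smul_eq_mul, abs_mul]
    rw [abs_of_pos (by norm_num : (0 : ℝ) < 2⁻¹)]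
    gcongr
    exact abs_add_le _ _
  have hsum : ∑ j, 2⁻¹ * (|b j| + |c j|) = ∑ j, |b j| := by
    rw [← Finset.mul_sum, Finset.sum_add_distrib]
    linarith
  have hmle := (Finset.sum_le_sum hle).trans_eq hsum
  refine ⟨⟨hX, fun g hg => hmle.trans (hb.2 g hg)⟩, fun j hj => ?_⟩
  -- Minimality of `b` makes the summed triangle inequality an equality, hence each term is one.
  have heq := (Finset.sum_eq_sum_iff_of_le hle).mp (by linarith) j (Finset.mem_univ j)
  rw [hj, abs_zero] at heq
  have h1 := abs_nonneg (b j)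
  have h2 := abs_nonneg (c j)
  exact ⟨abs_eq_zero.mp (by linarith), abs_eq_zero.mp (by linarith)⟩

/-- More than `n` columns of a matrix with `n` rows are linearly dependent. -/
theorem exists_ne_zero_mulVec_eq_zero_of_lt_card {n p : ℕ} (X : Matrix (Fin n) (Fin p) ℝ)
    (F : Finset (Fin p)) (hF : n < F.card) :
    ∃ h : Fin p → ℝ, h ≠ 0 ∧ X.mulVec h = 0 ∧ ∀ j ∉ F, h j = 0 := by
  classical
  have hdep : ¬ LinearIndependent ℝ fun j : F => X.col j := by
    intro hli
    have := hli.fintype_card_le_finrank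
    simp at this
    omega
  obtain ⟨g, hg, j, hj⟩ := Fintype.not_linearIndependent_iff.mp hdep
  refine ⟨fun k => if hk : k ∈ F then g ⟨k, hk⟩ else 0, fun h0 => hj ?_, ?_, fun k hk => dif_neg hk⟩
  · simpa using congrFun h0 j
  · ext i
    have := congrFun hg i
    simp only [Finset.sum_apply, Pi.smul_apply, Matrix.col_apply, smul_eq_mul,
      Pi.zero_apply] at this
    refine Eq.trans ?_ this
    rw [Matrix.mulVec, dotProduct,
      ← Finset.sum_subset (Finset.subset_univ F) fun k _ hk => by simp [hk],
      ← Finset.sum_coe_sort F]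
    exact Finset.sum_congr rfl fun k _ => by simp [mul_comm]

/-- If basis pursuit has two minimizers, then some nonzero kernel vector with at most `n + 1`
nonzero entries is orthogonal to a sign vector that does not vanish on its support. -/
theorem exists_sparse_mulVec_eq_zero_of_ne {n p : ℕ} {X : Matrix (Fin n) (Fin p) ℝ}
    {y : Fin n → ℝ} {b c : Fin p → ℝ} (hb : b ∈ bpMinimizers X y) (hc : c ∈ bpMinimizers X y)
    (hne : b ≠ c) :
    ∃ (F : Finset (Fin p)) (s : Fin p → SignType) (h : Fin p → ℝ), F.card ≤ n + 1 ∧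
      (∀ j ∈ F, s j ≠ 0) ∧ h ≠ 0 ∧ X.mulVec h = 0 ∧ (∀ j ∉ F, h j = 0) ∧
      (fun j => (s j : ℝ)) ⬝ᵥ h = 0 := by
  classical
  obtain ⟨hm, hsupp⟩ := midpoint_mem_bpMinimizers hb hc
  set m := (2⁻¹ : ℝ) • (b + c)
  set E : Finset (Fin p) := Finset.univ.filter fun j => m j ≠ 0
  have hE : ∀ j ∈ E, m j ≠ 0 := fun j hj => (Finset.mem_filter.mp hj).2
  obtain ⟨F, hFE, hF, h, h0, hXh, hh⟩ : ∃ F ⊆ E, F.card ≤ n + 1 ∧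
      ∃ h : Fin p → ℝ, h ≠ 0 ∧ X.mulVec h = 0 ∧ ∀ j ∉ F, h j = 0 := by
    by_cases hcard : E.card ≤ n + 1
    · refine ⟨E, subset_rfl, hcard, b - c, sub_ne_zero.mpr hne, ?_, fun j hj => ?_⟩
      · rw [Matrix.mulVec_sub, ((mem_bpMinimizers X y b).mp hb).1,
          ((mem_bpMinimizers X y c).mp hc).1, sub_self]
      · have := hsupp j (by simpa [E] using hj)
        simp [this.1, this.2]
    · obtain ⟨F, hFE, hF⟩ := Finset.exists_subset_card_eq (not_le.mp hcard).le
      exact ⟨F, hFE, hF.le, exists_ne_zero_mulVec_eq_zero_of_lt_card X F (by omega)⟩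
  refine ⟨F, fun j => SignType.sign (m j), h, hF, fun j hj => sign_ne_zero.mpr (hE j (hFE hj)),
    h0, hXh, hh, sign_dotProduct_eq_zero_of_mem_bpMinimizers hm hXh fun j hj => hh j fun hjF => ?_⟩
  exact hE j (hFE hjF) hj

/-- The matrix space `ℝ^{n×p}` is the space of entry functions `Fin n → Fin p → ℝ`, which carries
Lebesgue measure (the product of the Lebesgue measures of the entries). -/
theorem mainTheorem7 (n p : ℕ) :
    (volume : Measure (Fin n → Fin p → ℝ))
      {X | ∃ y : Fin n → ℝ, 1 < (bpMinimizers (Matrix.of X) y).encard} = 0 := by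
  have hae : ∀ᵐ X : Fin n → Fin p → ℝ, ∀ (F : Finset (Fin p)) (s : Fin p → SignType),
      F.card ≤ n + 1 → (∀ j ∈ F, s j ≠ 0) → ∀ h : Fin p → ℝ, (∀ j ∉ F, h j = 0) →
        (fun j => (s j : ℝ)) ⬝ᵥ h = 0 → (∀ i, X i ⬝ᵥ h = 0) → h = 0 := by
    refine ae_all_iff.mpr fun F => ae_all_iff.mpr fun s => ?_
    by_cases hF : F.card ≤ n + 1 ∧ ∀ j ∈ F, s j ≠ 0
    · obtain ⟨V, hV, hmem⟩ := exists_submodule_finrank_le_of_card_le F (fun j => (s j : ℝ)) hF.1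
        fun j hj hj0 => hF.2 j hj (by
          cases hsj : s j <;> simp_all)
      filter_upwards [ae_forall_mem_dotProduct_eq_zero n V hV] with X hX _ _ h hh hsh
      exact hX h (hmem h hh hsh)
    · exact Filter.Eventually.of_forall fun X h1 h2 => absurd ⟨h1, h2⟩ hF
  rw [measure_eq_zero_iff_ae_notMem]
  filter_upwards [hae] with X hX
  rintro ⟨y, hy⟩
  obtain ⟨b, c, hb, hc, hne⟩ := Set.one_lt_encard_iff.mp hy
  obtain ⟨F, s, h, hF, hs, h0, hXh, hh, hsh⟩ := exists_sparse_mulVec_eq_zero_of_ne hb hc hne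
  exact h0 (hX F s hF hs h hh hsh fun i => congrFun hXh i)
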